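/- Conventions. $\mathbb R_+=[0,\infty)$. For real vectors or matrices, $X\ge 0$, $X\le 0$, $X>0$, $X<0$ are meant entry by entry; for Hermitian matrices, $X\preceq 0$, $X\succeq 0$ ($X\prec 0$, $X\succ 0$) mean negative/positive semidefinite (definite). A real square matrix is Schur if all its complex eigenvalues satisfy $|\lambda|<1$. A pair $(A,B)$ with $A\in\mathbb R^{n\times n}$, $B\in\mathbb R^{n\times m}$ is anti-stabilizable if there is $K\in\mathbb R^{m\times n}$ such that all complex eigenvalues of $A+BK$ satisfy $|\lambda|>1$. **Theorem (discrete-time KYP lemma for positive systems).** Let $A\in\mathbb R_+^{n\times n}$ be Schur, let $B\in\mathbb R_+^{n\times m}$, and let $Q\in\mathbb R^{(n+m)\times(n+m)}$ be symmetric with all entries nonnegative except possibly the last $m$ diagonal ones. (a) If $(A,B)$ is anti-stabilizable, then the following statements are equivalent: 1. For all $\omega\in[0,\infty)$, $$\begin{bmatrix}(e^{i\omega}I-A)^{-1}B\\I\end{bmatrix}^*Q\begin{bmatrix}(e^{i\omega}I-A)^{-1}B\\I\end{bmatrix}\preceq 0.$$ 2. $$\begin{bmatrix}(I-A)^{-1}B\\I\end{bmatrix}^TQ\begin{bmatrix}(I-A)^{-1}B\\I\end{bmatrix}\preceq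 0.$$ 3. There exists a diagonal $P\succeq0$ such that $$Q+\begin{bmatrix}A^TPA-P&A^TPB\\B^TPA&B^TPB\end{bmatrix}\preceq 0.$$ 4. There exist $x,p\in\mathbb R_+^n$ and $u\in\mathbb R^m$ with $u>0$ such that $x\ge Ax+Bu$ and $$Q\begin{bmatrix}x\\u\end{bmatrix}+\begin{bmatrix}A^T-I\\B^T\end{bmatrix}p\le 0.$$ (b) Without assuming anti-stabilizability, the statements 1–4 with all inequalities replaced by strict ones are equivalent, that is: 1 and 2 with $\prec$ in place of $\preceq$; 3 with $\prec$ in place of $\preceq$ and with $P\succ 0$ or, equivalently, only $P\succeq0$; and 4 with $x>Ax+Bu$, with $<0$ in place of $\le 0$, and with $x,p,u>0$ or, equivalently, only $x,p,u\ge0$. -/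

import Mathlib

open Matrix
open scoped ComplexOrder

/-- A real square matrix is Schur if all its (complex) eigenvalues lie strictly inside the unit
circle. -/
def IsSchur {n : ℕ} (A : Matrix (Fin n) (Fin n) ℝ) : Prop :=
  ∀ z ∈ spectrum ℂ (A.map ((↑) : ℝ → ℂ)), ‖z‖ < 1

/-- The discrete-time pair `(A, B)` is anti-stabilizable if some real feedback matrix `K` places
all (complex) eigenvalues of `A + B K` strictly outside the unit circle. -/
def IsAntiStabilizable {n m : ℕ} (A : Matrix (Fin n) (Fin n) ℝ) (B : Matrix (Fin n) (Fin m) ℝ) :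
    Prop :=
  ∃ K : Matrix (Fin m) (Fin n) ℝ, ∀ z ∈ spectrum ℂ ((A + B * K).map ((↑) : ℝ → ℂ)), 1 < ‖z‖

/-- The Hermitian matrix `[(e^{iω} I - A)⁻¹ B; I]^* Q [(e^{iω} I - A)⁻¹ B; I]`. -/
noncomputable def freqMatrix {n m : ℕ} (A : Matrix (Fin n) (Fin n) ℝ) (B : Matrix (Fin n) (Fin m) ℝ)
    (Q : Matrix (Fin n ⊕ Fin m) (Fin n ⊕ Fin m) ℝ) (ω : ℝ) : Matrix (Fin m) (Fin m) ℂ :=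
  let G : Matrix (Fin n) (Fin m) ℂ :=
    (Complex.exp (Complex.I * (ω : ℂ)) • (1 : Matrix (Fin n) (Fin n) ℂ)
      - A.map ((↑) : ℝ → ℂ))⁻¹ * B.map ((↑) : ℝ → ℂ)
  let H : Matrix (Fin n ⊕ Fin m) (Fin m) ℂ := fromRows G (1 : Matrix (Fin m) (Fin m) ℂ)
  Hᴴ * Q.map ((↑) : ℝ → ℂ) * H

/-- The real symmetric matrix `[(I - A)⁻¹ B; I]ᵀ Q [(I - A)⁻¹ B; I]`. -/
noncomputable def staticMatrix {n m : ℕ} (A : Matrix (Fin n) (Fin n) ℝ)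
    (B : Matrix (Fin n) (Fin m) ℝ) (Q : Matrix (Fin n ⊕ Fin m) (Fin n ⊕ Fin m) ℝ) :
    Matrix (Fin m) (Fin m) ℝ :=
  let H : Matrix (Fin n ⊕ Fin m) (Fin m) ℝ :=
    fromRows ((1 - A)⁻¹ * B) (1 : Matrix (Fin m) (Fin m) ℝ)
  Hᵀ * Q * H

/-- The matrix `Q + [AᵀPA - P, AᵀPB; BᵀPA, BᵀPB]`. -/
def lmiMatrix {n m : ℕ} (A : Matrix (Fin n) (Fin n) ℝ) (B : Matrix (Fin n) (Fin m) ℝ)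
    (Q : Matrix (Fin n ⊕ Fin m) (Fin n ⊕ Fin m) ℝ) (P : Matrix (Fin n) (Fin n) ℝ) :
    Matrix (Fin n ⊕ Fin m) (Fin n ⊕ Fin m) ℝ :=
  Q + fromBlocks (Aᵀ * P * A - P) (Aᵀ * P * B) (Bᵀ * P * A) (Bᵀ * P * B)

/-- The vector `Q [x; u] + [Aᵀ - I; Bᵀ] p`. -/
def lpVector {n m : ℕ} (A : Matrix (Fin n) (Fin n) ℝ) (B : Matrix (Fin n) (Fin m) ℝ)
    (Q : Matrix (Fin n ⊕ Fin m) (Fin n ⊕ Fin m) ℝ) (x p : Fin n → ℝ) (u : Fin m → ℝ) :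
    Fin n ⊕ Fin m → ℝ :=
  Q *ᵥ Sum.elim x u + fromRows (Aᵀ - 1) Bᵀ *ᵥ p

/-! Everything is compared with the static matrix `M = Hᵀ Q H`, where `H = [G; I]` and `G = (I -
A)⁻¹ B`. The Neumann series gives `(I - A)⁻¹ ≥ 0`, hence `G ≥ 0`. The possibly negative entries of
`Q` meet only the identity block of `H`, so `M` is symmetric Metzler (nonnegative off the diagonal).
For such matrices, negative (semi)definiteness amounts to a positive vector `u` with `M u < 0` (`≤
0`).

Frequency condition: if `e^{iω} z = A z + B w`, the triangle inequality gives `|z| ≤ G |w|`, so the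
form at `ω` is at most the static form at `|w|`, and `ω = 0` is the static case (`re_freqMatrix_le`,
`freqMatrix_zero`).

Linear program: `u` comes from the Metzler criterion, and `x`, `p` solve equations with `I - A` and
its transpose (`exists_lpVector_eq`). Conversely, multiplying by `Hᵀ ≥ 0` eliminates `p`
(`staticMatrix_mulVec_le`).

Matrix inequality: evaluation at the equilibrium `x = G u` cancels `P` and returns `M`. Conversely,
a strict LP solution gives `P = diag(p / x)`: the LMI matrix is Metzler and sends `[x; u]` to a
negative vector (`exists_lmi_of_lp`). In the nonstrict case, `Q` is perturbed to make the problem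
strict, and anti-stabilizability bounds the resulting `P` uniformly, so a limit point exists
(`exists_bound_of_stein`). -/

section Metzler

/-! ### Symmetric Metzler matrices and positive test vectors. -/

variable {ι : Type*} [Fintype ι]

theorem dotProduct_mulVec_eq_sum_sum (N : Matrix ι ι ℝ) (v w : ι → ℝ) :
    v ⬝ᵥ (N *ᵥ w) = ∑ i, ∑ j, v i * N i j * w j := by
  simp only [dotProduct, mulVec, Finset.mul_sum, mul_assoc]

theorem Matrix.IsSymm.isHermitian_neg_real {κ : Type*} {N : Matrix κ κ ℝ} (h : N.IsSymm) :
    (-N).IsHermitian := by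
  rw [IsHermitian, conjTranspose_neg, conjTranspose_eq_transpose_of_trivial, h]

theorem Matrix.IsSymm.posSemidef_neg_iff {N : Matrix ι ι ℝ} (h : N.IsSymm) :
    (-N).PosSemidef ↔ ∀ w, w ⬝ᵥ (N *ᵥ w) ≤ 0 := by
  rw [posSemidef_iff_dotProduct_mulVec]
  simp only [h.isHermitian_neg_real, true_and, neg_mulVec, dotProduct_neg, star_trivial,
    Left.nonneg_neg_iff]

theorem Matrix.IsSymm.posDef_neg_iff {N : Matrix ι ι ℝ} (h : N.IsSymm) :
    (-N).PosDef ↔ ∀ w, w ≠ 0 → w ⬝ᵥ (N *ᵥ w) < 0 := by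
  rw [posDef_iff_dotProduct_mulVec]
  simp only [h.isHermitian_neg_real, true_and, neg_mulVec, dotProduct_neg, star_trivial,
    Left.neg_pos_iff]

/-- The quadratic form of a symmetric Metzler matrix is bounded by a weighted sum of squares. -/
theorem dotProduct_mulVec_le_of_metzler {N : Matrix ι ι ℝ} (hs : N.IsSymm)
    (hoff : ∀ i j, i ≠ j → 0 ≤ N i j) {y : ι → ℝ} (hy : ∀ i, 0 < y i) (w : ι → ℝ) :
    w ⬝ᵥ (N *ᵥ w) ≤ ∑ i, w i ^ 2 / y i * (N *ᵥ y) i := by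
  -- In the scaled variable `a = w / y`, the bound is `a i * a j ≤ (a i ^ 2 + a j ^ 2) / 2` off the
  -- diagonal; symmetry of `N` then merges the two halves.
  set a : ι → ℝ := fun i => w i / y i with ha
  have hw : ∀ i, w i = a i * y i := fun i => by simp [ha, (hy i).ne']
  have h1 : w ⬝ᵥ (N *ᵥ w) ≤ ∑ i, ∑ j, N i j * y i * y j * ((a i ^ 2 + a j ^ 2) / 2) := by
    rw [dotProduct_mulVec_eq_sum_sum]
    refine Finset.sum_le_sum fun i _ => Finset.sum_le_sum fun j _ => ?_
    rw [hw i, hw j]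
    by_cases hij : i = j
    · subst hij
      apply le_of_eq
      ring
    · have h0 : 0 ≤ N i j * y i * y j :=
        mul_nonneg (mul_nonneg (hoff i j hij) (hy i).le) (hy j).le
      nlinarith [mul_nonneg h0 (sq_nonneg (a i - a j))]
  have h2 : ∑ i, ∑ j, N i j * y i * y j * a j ^ 2 = ∑ i, ∑ j, N i j * y i * y j * a i ^ 2 := by
    rw [Finset.sum_comm]
    refine Finset.sum_congr rfl fun i _ => Finset.sum_congr rfl fun j _ => ?_
    rw [hs.apply]
    ring
  refine h1.trans_eq ?_
  have h3 : ∀ i j, N i j * y i * y j * ((a i ^ 2 + a j ^ 2) / 2)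
      = (N i j * y i * y j * a i ^ 2) / 2 + (N i j * y i * y j * a j ^ 2) / 2 := by
    intro i j
    ring
  simp only [h3, Finset.sum_add_distrib, ← Finset.sum_div]
  rw [h2, add_halves]
  refine Finset.sum_congr rfl fun i _ => ?_
  rw [mulVec, dotProduct, Finset.mul_sum]
  refine Finset.sum_congr rfl fun j _ => ?_
  rw [hw i]
  have := (hy i).ne'
  field_simp

theorem posSemidef_neg_of_metzler {N : Matrix ι ι ℝ} (hs : N.IsSymm)
    (hoff : ∀ i j, i ≠ j → 0 ≤ N i j) {y : ι → ℝ} (hy : ∀ i, 0 < y i)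
    (hN : ∀ i, (N *ᵥ y) i ≤ 0) : (-N).PosSemidef := by
  rw [hs.posSemidef_neg_iff]
  refine fun w => (dotProduct_mulVec_le_of_metzler hs hoff hy w).trans ?_
  exact Finset.sum_nonpos fun i _ =>
    mul_nonpos_of_nonneg_of_nonpos (div_nonneg (sq_nonneg _) (hy i).le) (hN i)

theorem posDef_neg_of_metzler {N : Matrix ι ι ℝ} (hs : N.IsSymm)
    (hoff : ∀ i j, i ≠ j → 0 ≤ N i j) {y : ι → ℝ} (hy : ∀ i, 0 < y i)
    (hN : ∀ i, (N *ᵥ y) i < 0) : (-N).PosDef := by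
  rw [hs.posDef_neg_iff]
  intro w hw
  refine (dotProduct_mulVec_le_of_metzler hs hoff hy w).trans_lt ?_
  obtain ⟨k, hk⟩ := Function.ne_iff.mp hw
  refine Finset.sum_neg' (fun i _ => mul_nonpos_of_nonneg_of_nonpos
    (div_nonneg (sq_nonneg _) (hy i).le) (hN i).le) ⟨k, Finset.mem_univ k, ?_⟩
  exact mul_neg_of_pos_of_neg (div_pos (sq_pos_of_ne_zero hk) (hy k)) (hN k)

/-- A nonnegative vector which a Metzler matrix maps to a negative one is positive. -/
theorem pos_of_metzler_mulVec_neg {N : Matrix ι ι ℝ} (hoff : ∀ i j, i ≠ j → 0 ≤ N i j)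
    {u : ι → ℝ} (hu : ∀ i, 0 ≤ u i) (hN : ∀ i, (N *ᵥ u) i < 0) (i : ι) : 0 < u i := by
  refine (hu i).lt_of_ne fun h => (hN i).not_ge ?_
  -- If `u i = 0`, the diagonal term of row `i` vanishes and all other terms are nonnegative.
  refine Finset.sum_nonneg fun j _ => ?_
  by_cases hij : i = j
  · subst hij
    simp [← h]
  · exact mul_nonneg (hoff i j hij) (hu j)

theorem dotProduct_mulVec_abs_of_metzler {N : Matrix ι ι ℝ}
    (hoff : ∀ i j, i ≠ j → 0 ≤ N i j) (w : ι → ℝ) :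
    w ⬝ᵥ (N *ᵥ w) ≤ |w| ⬝ᵥ (N *ᵥ |w|) := by
  simp only [dotProduct_mulVec_eq_sum_sum]
  refine Finset.sum_le_sum fun i _ => Finset.sum_le_sum fun j _ => ?_
  by_cases hij : i = j
  · subst hij
    have := abs_mul_abs_self (w i)
    simp only [Pi.abs_apply]
    apply le_of_eq
    linear_combination (-N i i) * this
  · have h1 := hoff i j hij
    have h2 : w i * w j ≤ |w i| * |w j| := by rw [← abs_mul]; exact le_abs_self _
    simp only [Pi.abs_apply]
    nlinarith [mul_le_mul_of_nonneg_left h2 h1]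

theorem exists_pos_mulVec_neg_of_metzler [DecidableEq ι] {N : Matrix ι ι ℝ} (hs : N.IsSymm)
    (hoff : ∀ i j, i ≠ j → 0 ≤ N i j) (hN : (-N).PosDef) :
    ∃ u : ι → ℝ, (∀ i, 0 < u i) ∧ ∀ i, (N *ᵥ u) i < 0 := by
  have hdet : IsUnit N.det := by
    have := hN.isUnit
    rwa [IsUnit.neg_iff, isUnit_iff_isUnit_det] at this
  set u : ι → ℝ := N⁻¹ *ᵥ (fun _ => -1) with hu
  have hNu : N *ᵥ u = fun _ => -1 := by
    rw [hu, mulVec_mulVec, mul_nonsing_inv _ hdet, one_mulVec]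
  have hNu' : ∀ i, (N *ᵥ u) i < 0 := fun i => by simp [hNu]
  refine ⟨u, ?_, hNu'⟩
  refine pos_of_metzler_mulVec_neg hoff ?_ hNu'
  rw [hs.posDef_neg_iff] at hN
  set v : ι → ℝ := fun i => max (-u i) 0 with hv
  have hv0 : ∀ i, 0 ≤ v i := fun i => le_max_right _ _
  -- `v` is the negative part of `u`. If it were nonzero, then `vᵀ N u ≥ -vᵀ N v > 0`, against `v ≥
  -- 0` and `N u < 0`.
  have hvv : v = 0 := by
    by_contra hne
    have h1 := hN v hne
    have h2 : -(v ⬝ᵥ (N *ᵥ v)) ≤ v ⬝ᵥ (N *ᵥ u) := by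
      simp only [dotProduct_mulVec_eq_sum_sum]
      rw [← Finset.sum_neg_distrib]
      refine Finset.sum_le_sum fun i _ => ?_
      rw [← Finset.sum_neg_distrib]
      refine Finset.sum_le_sum fun j _ => ?_
      by_cases hij : i = j
      · subst hij
        rcases le_total (u i) 0 with h | h
        · simp [hv, max_eq_left (neg_nonneg.2 h)]
        · simp [hv, max_eq_right (neg_nonpos.2 h)]
      · have h3 : -v j ≤ u j := by
          have := le_max_left (-u j) 0
          simp only [hv]; linarith
        have h4 := mul_le_mul_of_nonneg_left h3 (mul_nonneg (hv0 i) (hoff i j hij))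
        linarith
    have h5 : v ⬝ᵥ (N *ᵥ u) ≤ 0 :=
      Finset.sum_nonpos fun i _ => mul_nonpos_of_nonneg_of_nonpos (hv0 i) (hNu' i).le
    linarith
  intro i
  have := congrFun hvv i
  simp only [hv, Pi.zero_apply, max_eq_right_iff] at this
  linarith

/-- A negative semidefinite symmetric Metzler matrix maps some positive vector to a
nonpositive one. -/
theorem exists_pos_mulVec_nonpos_of_metzler {ι : Type*} [Fintype ι] [DecidableEq ι]
    {N : Matrix ι ι ℝ} (hs : N.IsSymm)
    (hoff : ∀ i j, i ≠ j → 0 ≤ N i j) (hN : (-N).PosSemidef) :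
    ∃ u : ι → ℝ, (∀ i, 0 < u i) ∧ ∀ i, (N *ᵥ u) i ≤ 0 := by
  induction h : Fintype.card ι using Nat.strong_induction_on generalizing ι with
  | _ c ih =>
  by_cases hpd : (-N).PosDef
  · obtain ⟨u, hu, hNu⟩ := exists_pos_mulVec_neg_of_metzler hs hoff hpd
    exact ⟨u, hu, fun i => (hNu i).le⟩
  rw [hs.posDef_neg_iff] at hpd
  push Not at hpd
  obtain ⟨w, hw, hNw⟩ := hpd
  -- Passing to `|w|` does not decrease the form, so `|w|` attains the maximum 0 of a semidefinite
  -- form and lies in the kernel.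
  have habs : N *ᵥ |w| = 0 := by
    have h1 := hNw.trans (dotProduct_mulVec_abs_of_metzler hoff w)
    have h2 := (hs.posSemidef_neg_iff.1 hN |w|)
    have h3 := (hN.dotProduct_mulVec_zero_iff |w|).1 (by
      simp only [star_trivial, neg_mulVec, dotProduct_neg]; linarith)
    simpa [neg_mulVec] using h3
  obtain ⟨k, hk⟩ := Function.ne_iff.mp hw
  have hk : w k ≠ 0 := hk
  -- In a row outside the support of `w`, the kernel equation is a vanishing sum of nonnegative
  -- terms. So `N` is block diagonal along the support and its complement.
  have hzero : ∀ i j, w i = 0 → w j ≠ 0 → N i j = 0 := by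
    intro i j hi hj
    have h1 : ∑ l, N i l * |w| l = 0 := congrFun habs i
    rw [Finset.sum_eq_zero_iff_of_nonneg] at h1
    · have h2 := h1 j (Finset.mem_univ j)
      simpa [hj] using h2
    · intro l _
      by_cases hil : i = l
      · subst hil
        simp [hi]
      · exact mul_nonneg (hoff i l hil) (abs_nonneg _)
  let T := {i // w i = 0}
  have hcard : Fintype.card T < c := h ▸ Fintype.card_subtype_lt hk
  obtain ⟨v, hv, hNv⟩ := ih (Fintype.card T) hcard (N := N.submatrix Subtype.val Subtype.val)
    (hs.submatrix _) (fun i j hij => hoff _ _ fun h => hij (Subtype.ext h))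
    (hN.submatrix Subtype.val) rfl
  -- Glue the kernel vector `|w|` on the support to the inductive vector on the complement.
  refine ⟨fun i => if hi : w i = 0 then v ⟨i, hi⟩ else |w i|, fun i => ?_, fun i => ?_⟩
  · dsimp only
    split_ifs with hi
    · exact hv _
    · exact abs_pos.2 hi
  · by_cases hi : w i = 0
    · refine le_trans (le_of_eq ?_) (hNv ⟨i, hi⟩)
      simp only [mulVec, dotProduct, submatrix_apply]
      rw [← Fintype.sum_subtype_add_sum_subtype (fun j => w j = 0)]
      rw [add_eq_left.2]
      · refine Finset.sum_congr rfl fun j _ => ?_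
        simp [j.2]
      · exact Finset.sum_eq_zero fun j _ => by simp [hzero i j hi j.2]
    · refine le_of_eq (Eq.trans ?_ (congrFun habs i))
      simp only [mulVec, dotProduct]
      refine Finset.sum_congr rfl fun j _ => ?_
      by_cases hj : w j = 0
      · have h1 : N i j = 0 := by rw [← hs.apply]; exact hzero j i hj hi
        simp [h1]
      · simp [hj]

end Metzler

/-! ### Powers of Schur matrices and the Neumann series. -/

open Filter Topology

section Schur

/-- Gelfand's formula makes `‖a ^ k‖` eventually at most `r ^ k` for any `r` strictly between the
spectral radius and 1. -/
theorem tendsto_pow_zero_of_spectralRadius_lt_one {R : Type*} [NormedRing R] [NormedAlgebra ℂ R]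
    [CompleteSpace R] {a : R} (h : spectralRadius ℂ a < 1) :
    Tendsto (fun k : ℕ => a ^ k) atTop (𝓝 0) := by
  obtain ⟨r, hr, hr1⟩ := ENNReal.lt_iff_exists_nnreal_btwn.1 h
  have hr1' : r < 1 := by exact_mod_cast hr1
  have hlim := spectrum.pow_nnnorm_pow_one_div_tendsto_nhds_spectralRadius a
  have hev : ∀ᶠ k : ℕ in atTop, ‖a ^ k‖ ≤ (r : ℝ) ^ k := by
    filter_upwards [hlim.eventually_lt_const hr, eventually_gt_atTop 0] with k hk hk0
    have h1 : ((‖a ^ k‖₊ : ENNReal) ^ (1 / k : ℝ)) ^ (k : ℝ) ≤ (r : ENNReal) ^ (k : ℝ) :=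
      ENNReal.rpow_le_rpow hk.le (Nat.cast_nonneg k)
    rw [← ENNReal.rpow_mul, one_div, inv_mul_cancel₀ (by positivity), ENNReal.rpow_one,
      ENNReal.rpow_natCast] at h1
    exact_mod_cast h1
  exact squeeze_zero_norm' hev (tendsto_pow_atTop_nhds_zero_of_lt_one r.2 (by exact_mod_cast hr1'))

attribute [local instance] Matrix.linftyOpNormedRing Matrix.linftyOpNormedAlgebra

variable {n : ℕ}

theorem tendsto_pow_zero_of_spectrum_lt_one {A : Matrix (Fin n) (Fin n) ℂ}
    (h : ∀ z ∈ spectrum ℂ A, ‖z‖ < 1) (i j : Fin n) :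
    Tendsto (fun k : ℕ => (A ^ k) i j) atTop (𝓝 0) := by
  -- The index `i` excludes the empty matrix, whose algebra is trivial.
  have : Nonempty (Fin n) := ⟨i⟩
  have : Nontrivial (Matrix (Fin n) (Fin n) ℂ) := inferInstance
  have h1 : spectralRadius ℂ A < (1 : NNReal) :=
    spectrum.spectralRadius_lt_of_forall_lt A fun z hz => by exact_mod_cast h z hz
  have h2 := tendsto_pow_zero_of_spectralRadius_lt_one (a := A) (by simpa using h1)
  exact (tendsto_pi_nhds.1 ((tendsto_pi_nhds.1 h2) i)) j

end Schur

theorem map_ofReal_pow {n : ℕ} (A : Matrix (Fin n) (Fin n) ℝ) (k : ℕ) :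
    (A ^ k).map ((↑) : ℝ → ℂ) = (A.map ((↑) : ℝ → ℂ)) ^ k :=
  map_pow (Complex.ofRealHom.mapMatrix (m := Fin n)) A k

theorem IsSchur.tendsto_pow {n : ℕ} {A : Matrix (Fin n) (Fin n) ℝ} (h : IsSchur A) (i j : Fin n) :
    Tendsto (fun k : ℕ => (A ^ k) i j) atTop (𝓝 0) := by
  have h1 := tendsto_pow_zero_of_spectrum_lt_one h i j
  simp only [← map_ofReal_pow, map_apply] at h1
  exact_mod_cast (Complex.continuous_re.tendsto _).comp h1

theorem isUnit_smul_one_sub_of_notMem_spectrum {n : ℕ} {A : Matrix (Fin n) (Fin n) ℂ} {z : ℂ}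
    (h : z ∉ spectrum ℂ A) : IsUnit (z • (1 : Matrix (Fin n) (Fin n) ℂ) - A).det := by
  rw [spectrum.notMem_iff, Algebra.algebraMap_eq_smul_one] at h
  exact (isUnit_iff_isUnit_det _).1 h

theorem isUnit_det_of_map_ofReal {n : ℕ} {A : Matrix (Fin n) (Fin n) ℝ}
    (h : IsUnit (A.map ((↑) : ℝ → ℂ)).det) : IsUnit A.det := by
  have h1 : (A.map ((↑) : ℝ → ℂ)).det = (A.det : ℂ) :=
    (RingHom.map_det Complex.ofRealHom A).symm
  rw [h1, isUnit_iff_ne_zero] at h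
  rw [isUnit_iff_ne_zero]
  exact_mod_cast h

theorem map_ofReal_one_sub {n : ℕ} (A : Matrix (Fin n) (Fin n) ℝ) :
    (1 - A).map ((↑) : ℝ → ℂ) = 1 - A.map ((↑) : ℝ → ℂ) := by
  have h := map_sub (Complex.ofRealHom.mapMatrix (m := Fin n)) 1 A
  rwa [map_one] at h

theorem IsSchur.isUnit_det {n : ℕ} {A : Matrix (Fin n) (Fin n) ℝ} (h : IsSchur A) :
    IsUnit (1 - A).det := by
  apply isUnit_det_of_map_ofReal
  rw [map_ofReal_one_sub]
  have h1 : (1 : ℂ) ∉ spectrum ℂ (A.map ((↑) : ℝ → ℂ)) := fun h1 => by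
    have := h 1 h1
    simp at this
  simpa using isUnit_smul_one_sub_of_notMem_spectrum h1

theorem pow_nonneg_entries {n : ℕ} {A : Matrix (Fin n) (Fin n) ℝ} (hA : ∀ i j, 0 ≤ A i j) (k : ℕ)
    (i j : Fin n) : 0 ≤ (A ^ k) i j := by
  induction k generalizing i j with
  | zero => rw [pow_zero, one_apply]; split_ifs <;> norm_num
  | succ k ih => rw [pow_succ, mul_apply]; exact Finset.sum_nonneg fun l _ => mul_nonneg (ih i l) (hA l j)

/-- The inverse of `1 - A` is entrywise nonnegative if `A ≥ 0` is Schur. -/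
theorem IsSchur.inv_nonneg {n : ℕ} {A : Matrix (Fin n) (Fin n) ℝ} (h : IsSchur A)
    (hA : ∀ i j, 0 ≤ A i j) (i j : Fin n) : 0 ≤ (1 - A)⁻¹ i j := by
  set R := (1 - A)⁻¹ with hR
  have h1 : ∀ k : ℕ, ∑ l ∈ Finset.range k, A ^ l = R - A ^ k * R := by
    intro k
    have h2 := geom_sum_mul_neg A k
    calc ∑ l ∈ Finset.range k, A ^ l = (∑ l ∈ Finset.range k, A ^ l) * (1 - A) * R := by
          rw [hR, mul_assoc, mul_nonsing_inv _ h.isUnit_det, mul_one]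
      _ = _ := by rw [h2, sub_mul, one_mul]
  have h3 : Tendsto (fun k : ℕ => (R - A ^ k * R) i j) atTop (𝓝 (R i j)) := by
    have h4 : Tendsto (fun k : ℕ => R i j - ∑ l, (A ^ k) i l * R l j) atTop
        (𝓝 (R i j - ∑ l, 0 * R l j)) :=
      tendsto_const_nhds.sub (tendsto_finsetSum _ fun l _ => (h.tendsto_pow i l).mul_const _)
    simpa [Matrix.sub_apply, mul_apply] using h4
  refine ge_of_tendsto' h3 fun k => ?_
  rw [← h1 k, Matrix.sum_apply]
  exact Finset.sum_nonneg fun l _ => pow_nonneg_entries hA l i j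

/-! ### Static matrix, matrix inequality and linear program. -/

section KYP

variable {n m : ℕ} {A : Matrix (Fin n) (Fin n) ℝ} {B : Matrix (Fin n) (Fin m) ℝ}
  {Q : Matrix (Fin n ⊕ Fin m) (Fin n ⊕ Fin m) ℝ}

theorem mulVec_nonneg_of_nonneg {ι κ : Type*} [Fintype κ] {N : Matrix ι κ ℝ} {v : κ → ℝ}
    (hN : ∀ i j, 0 ≤ N i j) (hv : ∀ j, 0 ≤ v j) (i : ι) : 0 ≤ (N *ᵥ v) i :=
  Finset.sum_nonneg fun j _ => mul_nonneg (hN i j) (hv j)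

theorem mulVec_mono_of_nonneg {ι κ : Type*} [Fintype κ] {N : Matrix ι κ ℝ} {v w : κ → ℝ}
    (hN : ∀ i j, 0 ≤ N i j) (hv : ∀ j, v j ≤ w j) (i : ι) : (N *ᵥ v) i ≤ (N *ᵥ w) i :=
  Finset.sum_le_sum fun j _ => mul_le_mul_of_nonneg_left (hv j) (hN i j)

theorem gain_nonneg (hA : ∀ i j, 0 ≤ A i j) (hA_schur : IsSchur A) (hB : ∀ i j, 0 ≤ B i j)
    (i : Fin n) (k : Fin m) : 0 ≤ ((1 - A)⁻¹ * B) i k := by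
  rw [mul_apply]
  exact Finset.sum_nonneg fun l _ => mul_nonneg (hA_schur.inv_nonneg hA i l) (hB l k)

theorem staticMatrix_isSymm (hQ : Q.IsSymm) : (staticMatrix A B Q).IsSymm := by
  simp only [IsSymm, staticMatrix, transpose_mul, transpose_transpose, hQ.eq, Matrix.mul_assoc]

theorem staticMatrix_mulVec (u : Fin m → ℝ) :
    staticMatrix A B Q *ᵥ u = (fromRows ((1 - A)⁻¹ * B) (1 : Matrix (Fin m) (Fin m) ℝ))ᵀ *ᵥ
      (Q *ᵥ Sum.elim (((1 - A)⁻¹ * B) *ᵥ u) u) := by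
  simp only [staticMatrix, ← mulVec_mulVec, fromRows_mulVec, one_mulVec]

theorem dotProduct_staticMatrix_mulVec (u : Fin m → ℝ) :
    u ⬝ᵥ (staticMatrix A B Q *ᵥ u) = Sum.elim (((1 - A)⁻¹ * B) *ᵥ u) u ⬝ᵥ
      (Q *ᵥ Sum.elim (((1 - A)⁻¹ * B) *ᵥ u) u) := by
  rw [staticMatrix_mulVec, dotProduct_mulVec, vecMul_transpose, fromRows_mulVec, one_mulVec]

theorem staticMatrix_offDiag_nonneg (hA : ∀ i j, 0 ≤ A i j) (hA_schur : IsSchur A)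
    (hB : ∀ i j, 0 ≤ B i j)
    (hQ : ∀ i j, (¬ ∃ k : Fin m, i = Sum.inr k ∧ j = Sum.inr k) → 0 ≤ Q i j)
    (k l : Fin m) (hkl : k ≠ l) : 0 ≤ staticMatrix A B Q k l := by
  have hG := gain_nonneg hA hA_schur hB
  have h1 : ∀ i j, 0 ≤ (1 : Matrix (Fin m) (Fin m) ℝ) i j := fun i j => by
    rw [one_apply]; split_ifs <;> norm_num
  simp only [staticMatrix, mul_apply, Finset.sum_mul]
  refine Finset.sum_nonneg fun j _ => Finset.sum_nonneg fun i _ => ?_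
  have hH : ∀ i j, 0 ≤ fromRows ((1 - A)⁻¹ * B) (1 : Matrix (Fin m) (Fin m) ℝ) i j := by
    rintro (i | i) j
    · exact hG i j
    · exact h1 i j
  -- A diagonal entry of the lower block of `Q` enters with the weight `I a k * I a l`, which is
  -- zero for `k ≠ l`.
  by_cases h : ∃ k : Fin m, i = Sum.inr k ∧ j = Sum.inr k
  · obtain ⟨a, rfl, rfl⟩ := h
    apply le_of_eq
    simp only [transpose_apply, fromRows_apply_inr, one_apply]
    by_cases hak : a = k
    · subst hak; simp [hkl]
    · simp [hak]
  · exact mul_nonneg (mul_nonneg (hH _ _) (hQ i j h)) (hH _ _)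

theorem lmiMatrix_mulVec (P : Matrix (Fin n) (Fin n) ℝ) (x : Fin n → ℝ) (u : Fin m → ℝ) :
    lmiMatrix A B Q P *ᵥ Sum.elim x u = Q *ᵥ Sum.elim x u +
      Sum.elim (Aᵀ *ᵥ (P *ᵥ (A *ᵥ x + B *ᵥ u)) - P *ᵥ x) (Bᵀ *ᵥ (P *ᵥ (A *ᵥ x + B *ᵥ u))) := by
  rw [lmiMatrix, add_mulVec, fromBlocks_mulVec]
  congr 1
  simp only [Sum.elim_comp_inl, Sum.elim_comp_inr, sub_mulVec, mulVec_add, mulVec_mulVec,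
    Matrix.mul_assoc]
  congr 1
  abel

theorem dotProduct_lmiMatrix_mulVec (P : Matrix (Fin n) (Fin n) ℝ) (x : Fin n → ℝ)
    (u : Fin m → ℝ) :
    Sum.elim x u ⬝ᵥ (lmiMatrix A B Q P *ᵥ Sum.elim x u) =
      Sum.elim x u ⬝ᵥ (Q *ᵥ Sum.elim x u) +
      (A *ᵥ x + B *ᵥ u) ⬝ᵥ (P *ᵥ (A *ᵥ x + B *ᵥ u)) - x ⬝ᵥ (P *ᵥ x) := by
  rw [lmiMatrix_mulVec, dotProduct_add, sumElim_dotProduct_sumElim, dotProduct_sub,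
    dotProduct_mulVec x, dotProduct_mulVec u Bᵀ, vecMul_transpose, vecMul_transpose, add_dotProduct]
  ring

theorem lmiMatrix_isSymm (hQ : Q.IsSymm) (d : Fin n → ℝ) :
    (lmiMatrix A B Q (diagonal d)).IsSymm := by
  refine hQ.add (IsSymm.fromBlocks ?_ ?_ ?_) <;>
  simp [IsSymm, transpose_mul, Matrix.mul_assoc]

theorem lmiMatrix_offDiag_nonneg (hA : ∀ i j, 0 ≤ A i j) (hB : ∀ i j, 0 ≤ B i j)
    (hQ : ∀ i j, (¬ ∃ k : Fin m, i = Sum.inr k ∧ j = Sum.inr k) → 0 ≤ Q i j)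
    {d : Fin n → ℝ} (hd : ∀ i, 0 ≤ d i) (i j : Fin n ⊕ Fin m) (hij : i ≠ j) :
    0 ≤ lmiMatrix A B Q (diagonal d) i j := by
  have hQ' := hQ i j (by rintro ⟨k, rfl, rfl⟩; exact hij rfl)
  have key : ∀ {κ κ' : Type} (C : Matrix (Fin n) κ ℝ) (D : Matrix (Fin n) κ' ℝ),
      (∀ i j, 0 ≤ C i j) → (∀ i j, 0 ≤ D i j) → ∀ i j, 0 ≤ (Cᵀ * diagonal d * D) i j := by
    intro κ κ' C D hC hD i j
    rw [mul_apply]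
    refine Finset.sum_nonneg fun l _ => ?_
    rw [mul_diagonal]
    exact mul_nonneg (mul_nonneg (hC _ _) (hd _)) (hD _ _)
  rw [lmiMatrix, Matrix.add_apply]
  refine add_nonneg hQ' ?_
  rcases i with i | i <;> rcases j with j | j
  · have : i ≠ j := fun h => hij (by rw [h])
    simpa [diagonal_apply_ne d this] using key A A hA hA i j
  · exact key A B hA hB i j
  · exact key B A hB hA i j
  · exact key B B hB hB i j

/-- At the equilibrium `x = G u` one has `A x + B u = x`, so the two `P` terms cancel for every `P`.
-/
theorem staticMatrix_eq_lmi (hA_schur : IsSchur A) (P : Matrix (Fin n) (Fin n) ℝ) (u : Fin m → ℝ) :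
    u ⬝ᵥ (staticMatrix A B Q *ᵥ u) =
      Sum.elim (((1 - A)⁻¹ * B) *ᵥ u) u ⬝ᵥ
        (lmiMatrix A B Q P *ᵥ Sum.elim (((1 - A)⁻¹ * B) *ᵥ u) u) := by
  have h : A *ᵥ (((1 - A)⁻¹ * B) *ᵥ u) + B *ᵥ u = ((1 - A)⁻¹ * B) *ᵥ u := by
    have h1 : (1 - A) *ᵥ (((1 - A)⁻¹ * B) *ᵥ u) = B *ᵥ u := by
      rw [mulVec_mulVec, mul_nonsing_inv_cancel_left _ _ hA_schur.isUnit_det]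
    rw [sub_mulVec, one_mulVec] at h1
    rw [← h1]
    abel
  rw [dotProduct_lmiMatrix_mulVec, h, dotProduct_staticMatrix_mulVec]
  ring

theorem staticMatrix_posSemidef_of_lmi (hA_schur : IsSchur A) (hQ : Q.IsSymm)
    {P : Matrix (Fin n) (Fin n) ℝ} (h : (-lmiMatrix A B Q P).PosSemidef) :
    (-staticMatrix A B Q).PosSemidef := by
  rw [(staticMatrix_isSymm hQ).posSemidef_neg_iff]
  intro u
  rw [staticMatrix_eq_lmi hA_schur P]
  have := h.dotProduct_mulVec_nonneg (Sum.elim (((1 - A)⁻¹ * B) *ᵥ u) u)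
  simpa [neg_mulVec] using this

theorem staticMatrix_posDef_of_lmi (hA_schur : IsSchur A) (hQ : Q.IsSymm)
    {P : Matrix (Fin n) (Fin n) ℝ} (h : (-lmiMatrix A B Q P).PosDef) :
    (-staticMatrix A B Q).PosDef := by
  rw [(staticMatrix_isSymm hQ).posDef_neg_iff]
  intro u hu
  rw [staticMatrix_eq_lmi hA_schur P]
  have hne : Sum.elim (((1 - A)⁻¹ * B) *ᵥ u) u ≠ 0 := fun h0 =>
    hu (funext fun k => congrFun h0 (Sum.inr k))
  have := h.dotProduct_mulVec_pos hne
  simpa [neg_mulVec] using this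

/-- The multiplier `p` drops out because `Hᵀ [Aᵀ - I; Bᵀ] = 0`. -/
theorem transpose_mulVec_lpVector (hA_schur : IsSchur A) (x p : Fin n → ℝ) (u : Fin m → ℝ) :
    (fromRows ((1 - A)⁻¹ * B) (1 : Matrix (Fin m) (Fin m) ℝ))ᵀ *ᵥ lpVector A B Q x p u =
      (fromRows ((1 - A)⁻¹ * B) (1 : Matrix (Fin m) (Fin m) ℝ))ᵀ *ᵥ (Q *ᵥ Sum.elim x u) := by
  have h : (fromRows ((1 - A)⁻¹ * B) (1 : Matrix (Fin m) (Fin m) ℝ))ᵀ *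
      fromRows (Aᵀ - 1) Bᵀ = 0 := by
    have h1 : Aᵀ - 1 = -(1 - A)ᵀ := by rw [transpose_sub, transpose_one, neg_sub]
    rw [transpose_fromRows, fromCols_mul_fromRows, transpose_one, Matrix.one_mul, h1,
      Matrix.mul_neg, ← transpose_mul, mul_nonsing_inv_cancel_left _ _ hA_schur.isUnit_det,
      neg_add_cancel]
  rw [lpVector, mulVec_add, mulVec_mulVec p, h, zero_mulVec, add_zero]

/-- Since `(I - A)⁻¹ ≥ 0`, the constraint on `x` yields `G u ≤ x`. Replacing `G u` by `x` only
involves the first `n` columns of `Q`, which are nonnegative, and `Hᵀ ≥ 0` preserves the inequality.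
-/
theorem staticMatrix_mulVec_le (hA : ∀ i j, 0 ≤ A i j) (hA_schur : IsSchur A)
    (hB : ∀ i j, 0 ≤ B i j)
    (hQ : ∀ i j, (¬ ∃ k : Fin m, i = Sum.inr k ∧ j = Sum.inr k) → 0 ≤ Q i j)
    {x p : Fin n → ℝ} {u : Fin m → ℝ} (hx : ∀ i, (A *ᵥ x + B *ᵥ u) i ≤ x i) (k : Fin m) :
    (staticMatrix A B Q *ᵥ u) k ≤ ∑ i, ((1 - A)⁻¹ * B) i k * lpVector A B Q x p u (Sum.inl i) +
      lpVector A B Q x p u (Sum.inr k) := by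
  have hG := gain_nonneg hA hA_schur hB
  set H := fromRows ((1 - A)⁻¹ * B) (1 : Matrix (Fin m) (Fin m) ℝ) with hH
  have hH0 : ∀ k i, 0 ≤ Hᵀ k i := by
    rintro k (i | i)
    · exact hG i k
    · simp only [hH, transpose_apply, fromRows_apply_inr, one_apply]
      split_ifs <;> norm_num
  have h1 : (Hᵀ *ᵥ lpVector A B Q x p u) k =
      ∑ i, ((1 - A)⁻¹ * B) i k * lpVector A B Q x p u (Sum.inl i) +
      lpVector A B Q x p u (Sum.inr k) := by
    simp [mulVec, dotProduct, hH, one_apply]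
  rw [← h1, transpose_mulVec_lpVector hA_schur, staticMatrix_mulVec]
  refine mulVec_mono_of_nonneg hH0 (fun i => ?_) k
  have hGx : ∀ j, (((1 - A)⁻¹ * B) *ᵥ u) j ≤ x j := by
    intro j
    have h2 : x = (1 - A)⁻¹ *ᵥ ((1 - A) *ᵥ x) := by
      rw [mulVec_mulVec, nonsing_inv_mul _ hA_schur.isUnit_det, one_mulVec]
    rw [h2, ← mulVec_mulVec]
    refine mulVec_mono_of_nonneg (hA_schur.inv_nonneg hA) (fun l => ?_) j
    have := hx l
    simp only [sub_mulVec, one_mulVec, Pi.sub_apply, Pi.add_apply] at this ⊢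
    linarith
  simp only [mulVec, dotProduct]
  refine Finset.sum_le_sum fun j _ => ?_
  rcases j with j | j
  · exact mul_le_mul_of_nonneg_left (hGx j) (hQ _ _ (by rintro ⟨k, -, h⟩; cases h))
  · exact le_rfl

/-- A family of candidates for the linear programming condition. -/
theorem exists_lpVector_eq (hA : ∀ i j, 0 ≤ A i j) (hA_schur : IsSchur A)
    (hB : ∀ i j, 0 ≤ B i j)
    (hQ : ∀ i j, (¬ ∃ k : Fin m, i = Sum.inr k ∧ j = Sum.inr k) → 0 ≤ Q i j)
    {u : Fin m → ℝ} (hu : ∀ k, 0 ≤ u k) :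
    ∃ c : Fin m → ℝ, ∀ t : ℝ, 0 ≤ t → ∃ x p : Fin n → ℝ, (∀ i, t ≤ x i) ∧ (∀ i, t ≤ p i) ∧
      (∀ i, (A *ᵥ x + B *ᵥ u) i = x i - t) ∧ (∀ i, lpVector A B Q x p u (Sum.inl i) = -t) ∧
      ∀ k, lpVector A B Q x p u (Sum.inr k) = (staticMatrix A B Q *ᵥ u) k + t * c k := by
  have hR := hA_schur.inv_nonneg hA
  have hdet := hA_schur.isUnit_det
  set R := (1 - A)⁻¹ with hRdef
  set H := fromRows (R * B) (1 : Matrix (Fin m) (Fin m) ℝ) with hH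
  let one : Fin n → ℝ := fun _ => 1
  -- `c` is the derivative in `t` of the lower block; it is read off from
  -- `transpose_mulVec_lpVector` once the upper block is known to be `-t`.
  refine ⟨fun k => (Hᵀ *ᵥ (Q *ᵥ Sum.elim (R *ᵥ one) 0)) k + ((R * B)ᵀ *ᵥ one) k, fun t ht => ?_⟩
  -- `x` and `p` solve the upper constraints with slack exactly `t` in each coordinate: `t = 0`
  -- serves the nonstrict program, small `t > 0` the strict one.
  set x := R *ᵥ (B *ᵥ u + t • one) with hx
  have hxA : (1 - A) *ᵥ x = B *ᵥ u + t • one := by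
    rw [hx, mulVec_mulVec, mul_nonsing_inv _ hdet, one_mulVec]
  set q : Fin n → ℝ := fun i => (Q *ᵥ Sum.elim x u) (Sum.inl i) with hq
  set p := Rᵀ *ᵥ (q + t • one) with hp
  have hpA : (1 - A)ᵀ *ᵥ p = q + t • one := by
    rw [hp, mulVec_mulVec, ← transpose_mul, nonsing_inv_mul _ hdet, transpose_one, one_mulVec]
  have hBu : ∀ i, 0 ≤ (B *ᵥ u) i := mulVec_nonneg_of_nonneg hB hu
  have hx0 : ∀ i, 0 ≤ x i := mulVec_nonneg_of_nonneg hR fun i => by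
    have := hBu i
    simp only [Pi.add_apply, Pi.smul_apply, smul_eq_mul, one]
    linarith
  have hq0 : ∀ i, 0 ≤ q i := fun i => by
    simp only [hq, mulVec, dotProduct]
    refine Finset.sum_nonneg fun j _ => ?_
    rcases j with j | j
    · exact mul_nonneg (hQ _ _ (by rintro ⟨k, h, -⟩; cases h)) (hx0 j)
    · exact mul_nonneg (hQ _ _ (by rintro ⟨k, h, -⟩; cases h)) (hu j)
  have hp0 : ∀ i, 0 ≤ p i := mulVec_nonneg_of_nonneg (fun i j => hR j i) fun i => by
    have := hq0 i
    simp only [Pi.add_apply, Pi.smul_apply, smul_eq_mul, one]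
    linarith
  have hxi : ∀ i, x i - (A *ᵥ x) i = (B *ᵥ u) i + t := fun i => by
    have := congrFun hxA i
    simpa [sub_mulVec, one] using this
  have hpi : ∀ i, p i - (Aᵀ *ᵥ p) i = q i + t := fun i => by
    have := congrFun hpA i
    simpa [sub_mulVec, transpose_sub, one] using this
  have hinl : ∀ i, lpVector A B Q x p u (Sum.inl i) = -t := fun i => by
    have h1 := hpi i
    have h2 : lpVector A B Q x p u (Sum.inl i) = q i + ((Aᵀ *ᵥ p) i - p i) := by
      simp [lpVector, fromRows_mulVec, sub_mulVec, hq]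
    rw [h2]
    linarith
  refine ⟨x, p, fun i => ?_, fun i => ?_, fun i => ?_, hinl, fun k => ?_⟩
  · have h1 := hxi i
    have h2 := mulVec_nonneg_of_nonneg hA hx0 i
    have h3 := hBu i
    linarith
  · have h1 := hpi i
    have h2 : 0 ≤ (Aᵀ *ᵥ p) i := mulVec_nonneg_of_nonneg (fun i j => hA j i) hp0 i
    have h3 := hq0 i
    linarith
  · have h1 := hxi i
    rw [Pi.add_apply]
    linarith
  · have h1 := congrFun (transpose_mulVec_lpVector (B := B) (Q := Q) hA_schur x p u) k
    rw [← hRdef, ← hH] at h1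
    have h2 : (Hᵀ *ᵥ lpVector A B Q x p u) k =
        ∑ i, (R * B) i k * lpVector A B Q x p u (Sum.inl i) +
        lpVector A B Q x p u (Sum.inr k) := by
      simp [mulVec, dotProduct, hH, one_apply]
    have h3 : Sum.elim x u = Sum.elim ((R * B) *ᵥ u) u + t • Sum.elim (R *ᵥ one) (0 : Fin m → ℝ) := by
      ext (i | i)
      · simp [hx, mulVec_add, mulVec_smul, mulVec_mulVec]
      · simp
    have h4 : ((R * B)ᵀ *ᵥ one) k = ∑ i, (R * B) i k := by
      simp [mulVec, dotProduct, one]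
    rw [h2, h3, mulVec_add, mulVec_add, mulVec_smul, mulVec_smul] at h1
    simp only [Pi.add_apply, Pi.smul_apply, smul_eq_mul, hinl, ← Finset.sum_mul] at h1
    rw [staticMatrix_mulVec, ← hRdef, ← hH]
    dsimp only
    rw [h4]
    linarith

/-- With `P = diag(p / x)` one has `P x = p` and `P (A x + B u) ≤ p`. Hence the LMI matrix maps `[x;
u]` below the LP vector, and the Metzler criterion applies. -/
theorem exists_lmi_of_lp (hA : ∀ i j, 0 ≤ A i j) (hB : ∀ i j, 0 ≤ B i j) (hQs : Q.IsSymm)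
    (hQ : ∀ i j, (¬ ∃ k : Fin m, i = Sum.inr k ∧ j = Sum.inr k) → 0 ≤ Q i j)
    {x p : Fin n → ℝ} {u : Fin m → ℝ} (hx : ∀ i, 0 < x i) (hp : ∀ i, 0 < p i)
    (hu : ∀ k, 0 < u k) (hAx : ∀ i, (A *ᵥ x + B *ᵥ u) i ≤ x i)
    (hlp : ∀ j, lpVector A B Q x p u j < 0) :
    ∃ d : Fin n → ℝ, (∀ i, 0 < d i) ∧ (-lmiMatrix A B Q (diagonal d)).PosDef := by
  have hd : ∀ i, 0 < p i / x i := fun i => div_pos (hp i) (hx i)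
  refine ⟨fun i => p i / x i, hd, ?_⟩
  refine posDef_neg_of_metzler (lmiMatrix_isSymm hQs _)
    (lmiMatrix_offDiag_nonneg hA hB hQ fun i => (hd i).le) (y := Sum.elim x u) ?_ ?_
  · rintro (i | i)
    exacts [hx i, hu i]
  have hPx : (diagonal fun i => p i / x i) *ᵥ x = p := by
    ext i
    rw [mulVec_diagonal, div_mul_cancel₀ _ (hx i).ne']
  have hle : ∀ i, ((diagonal fun i => p i / x i) *ᵥ (A *ᵥ x + B *ᵥ u)) i ≤ p i := fun i => by
    conv_rhs => rw [← hPx]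
    rw [mulVec_diagonal, mulVec_diagonal]
    exact mul_le_mul_of_nonneg_left (hAx i) (hd i).le
  intro j
  refine lt_of_le_of_lt ?_ (hlp j)
  rw [lmiMatrix_mulVec, hPx, lpVector, fromRows_mulVec, Pi.add_apply, Pi.add_apply]
  refine add_le_add le_rfl ?_
  rcases j with j | j
  · simp only [Sum.elim_inl, sub_mulVec, one_mulVec, Pi.sub_apply]
    exact sub_le_sub_right (mulVec_mono_of_nonneg (fun i j => hA j i) hle j) _
  · simp only [Sum.elim_inr]
    exact mulVec_mono_of_nonneg (fun i j => hB j i) hle j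

theorem exists_lp_of_staticMatrix_posSemidef (hA : ∀ i j, 0 ≤ A i j) (hA_schur : IsSchur A)
    (hB : ∀ i j, 0 ≤ B i j) (hQs : Q.IsSymm)
    (hQ : ∀ i j, (¬ ∃ k : Fin m, i = Sum.inr k ∧ j = Sum.inr k) → 0 ≤ Q i j)
    (h : (-staticMatrix A B Q).PosSemidef) :
    ∃ (x p : Fin n → ℝ) (u : Fin m → ℝ),
      (∀ i, 0 ≤ x i) ∧ (∀ i, 0 ≤ p i) ∧ (∀ k, 0 < u k) ∧
      (∀ i, (A *ᵥ x + B *ᵥ u) i ≤ x i) ∧ (∀ j, lpVector A B Q x p u j ≤ 0) := by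
  obtain ⟨u, hu, hMu⟩ := exists_pos_mulVec_nonpos_of_metzler (staticMatrix_isSymm hQs)
    (staticMatrix_offDiag_nonneg hA hA_schur hB hQ) h
  obtain ⟨c, hc⟩ := exists_lpVector_eq hA hA_schur hB hQ fun k => (hu k).le
  obtain ⟨x, p, hx, hp, hAx, hl, hr⟩ := hc 0 le_rfl
  refine ⟨x, p, u, hx, hp, hu, fun i => by simp [hAx i], ?_⟩
  rintro (i | k)
  · simp [hl i]
  · simpa [hr k] using hMu k

theorem exists_lp_of_staticMatrix_posDef (hA : ∀ i j, 0 ≤ A i j) (hA_schur : IsSchur A)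
    (hB : ∀ i j, 0 ≤ B i j) (hQs : Q.IsSymm)
    (hQ : ∀ i j, (¬ ∃ k : Fin m, i = Sum.inr k ∧ j = Sum.inr k) → 0 ≤ Q i j)
    (h : (-staticMatrix A B Q).PosDef) :
    ∃ (x p : Fin n → ℝ) (u : Fin m → ℝ),
      (∀ i, 0 < x i) ∧ (∀ i, 0 < p i) ∧ (∀ k, 0 < u k) ∧
      (∀ i, (A *ᵥ x + B *ᵥ u) i < x i) ∧ (∀ j, lpVector A B Q x p u j < 0) := by
  obtain ⟨u, hu, hMu⟩ := exists_pos_mulVec_neg_of_metzler (staticMatrix_isSymm hQs)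
    (staticMatrix_offDiag_nonneg hA hA_schur hB hQ) h
  obtain ⟨c, hc⟩ := exists_lpVector_eq hA hA_schur hB hQ fun k => (hu k).le
  -- The strict inequalities `M u < 0` survive a small perturbation `t c`.
  have hev : ∀ᶠ t : ℝ in 𝓝[>] 0, ∀ k, (staticMatrix A B Q *ᵥ u) k + t * c k < 0 := by
    rw [eventually_all]
    intro k
    have hcont : Tendsto (fun t : ℝ => (staticMatrix A B Q *ᵥ u) k + t * c k) (𝓝 0)
        (𝓝 ((staticMatrix A B Q *ᵥ u) k + 0 * c k)) :=
      (Continuous.tendsto (by fun_prop) 0)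
    exact (hcont.mono_left nhdsWithin_le_nhds).eventually_lt_const (by simpa using hMu k)
  obtain ⟨t, ht, ht0⟩ := (hev.and self_mem_nhdsWithin).exists
  have ht0 : 0 < t := ht0
  obtain ⟨x, p, hx, hp, hAx, hl, hr⟩ := hc t ht0.le
  refine ⟨x, p, u, fun i => ht0.trans_le (hx i), fun i => ht0.trans_le (hp i), hu,
    fun i => by rw [hAx i]; linarith, ?_⟩
  rintro (i | k)
  · rw [hl i]; linarith
  · rw [hr k]; exact ht k

theorem staticMatrix_posSemidef_of_lp (hA : ∀ i j, 0 ≤ A i j) (hA_schur : IsSchur A)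
    (hB : ∀ i j, 0 ≤ B i j) (hQs : Q.IsSymm)
    (hQ : ∀ i j, (¬ ∃ k : Fin m, i = Sum.inr k ∧ j = Sum.inr k) → 0 ≤ Q i j)
    {x p : Fin n → ℝ} {u : Fin m → ℝ} (hu : ∀ k, 0 < u k)
    (hAx : ∀ i, (A *ᵥ x + B *ᵥ u) i ≤ x i) (hlp : ∀ j, lpVector A B Q x p u j ≤ 0) :
    (-staticMatrix A B Q).PosSemidef := by
  refine posSemidef_neg_of_metzler (staticMatrix_isSymm hQs)
    (staticMatrix_offDiag_nonneg hA hA_schur hB hQ) hu fun k => ?_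
  refine (staticMatrix_mulVec_le hA hA_schur hB hQ (p := p) hAx k).trans ?_
  exact add_nonpos (Finset.sum_nonpos fun i _ =>
    mul_nonpos_of_nonneg_of_nonpos (gain_nonneg hA hA_schur hB i k) (hlp _)) (hlp _)

theorem staticMatrix_posDef_of_lp (hA : ∀ i j, 0 ≤ A i j) (hA_schur : IsSchur A)
    (hB : ∀ i j, 0 ≤ B i j) (hQs : Q.IsSymm)
    (hQ : ∀ i j, (¬ ∃ k : Fin m, i = Sum.inr k ∧ j = Sum.inr k) → 0 ≤ Q i j)
    {x p : Fin n → ℝ} {u : Fin m → ℝ} (hu : ∀ k, 0 ≤ u k)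
    (hAx : ∀ i, (A *ᵥ x + B *ᵥ u) i ≤ x i) (hlp : ∀ j, lpVector A B Q x p u j < 0) :
    (-staticMatrix A B Q).PosDef := by
  have hoff := staticMatrix_offDiag_nonneg hA hA_schur hB hQ
  have hneg : ∀ k, (staticMatrix A B Q *ᵥ u) k < 0 := fun k => by
    refine (staticMatrix_mulVec_le hA hA_schur hB hQ (p := p) hAx k).trans_lt ?_
    exact add_neg_of_nonpos_of_neg (Finset.sum_nonpos fun i _ =>
      mul_nonpos_of_nonneg_of_nonpos (gain_nonneg hA hA_schur hB i k) (hlp _).le) (hlp _)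
  exact posDef_neg_of_metzler (staticMatrix_isSymm hQs) hoff
    (pos_of_metzler_mulVec_neg hoff hu hneg) hneg

end KYP

/-! ### Domination of all frequencies by the static case. -/

section Frequency

variable {n m : ℕ} {A : Matrix (Fin n) (Fin n) ℝ} {B : Matrix (Fin n) (Fin m) ℝ}
  {Q : Matrix (Fin n ⊕ Fin m) (Fin n ⊕ Fin m) ℝ}

theorem map_ofReal_isHermitian {ι : Type*} {N : Matrix ι ι ℝ} (h : N.IsSymm) :
    (N.map ((↑) : ℝ → ℂ)).IsHermitian := by
  ext i j
  simp [h.apply i j]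

theorem freqMatrix_isHermitian (hQs : Q.IsSymm) (ω : ℝ) : (freqMatrix A B Q ω).IsHermitian :=
  isHermitian_conjTranspose_mul_mul _ (map_ofReal_isHermitian hQs)

theorem re_dotProduct_mulVec_le_of_metzler {ι : Type*} [Fintype ι] {N : Matrix ι ι ℝ}
    (hoff : ∀ i j, i ≠ j → 0 ≤ N i j) (h : ι → ℂ) :
    (star h ⬝ᵥ (N.map ((↑) : ℝ → ℂ) *ᵥ h)).re ≤
      (fun i => ‖h i‖) ⬝ᵥ (N *ᵥ fun i => ‖h i‖) := by
  rw [dotProduct_mulVec_eq_sum_sum]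
  simp only [dotProduct, mulVec, Finset.mul_sum, Complex.re_sum, map_apply]
  refine Finset.sum_le_sum fun i _ => Finset.sum_le_sum fun j _ => ?_
  have h1 : (star h i * ((N i j : ℂ) * h j)).re = N i j * (star (h i) * h j).re := by
    rw [mul_left_comm, Complex.re_ofReal_mul]
    rfl
  rw [h1]
  by_cases hij : i = j
  · subst hij
    have h2 : star (h i) * h i = ((‖h i‖ ^ 2 : ℝ) : ℂ) := by
      rw [mul_comm]
      simpa using Complex.mul_conj' (h i)
    rw [h2, Complex.ofReal_re]
    apply le_of_eq
    ring
  · have h2 : (star (h i) * h j).re ≤ ‖h i‖ * ‖h j‖ := by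
      refine (Complex.re_le_norm _).trans_eq ?_
      rw [norm_mul, norm_star]
    calc N i j * (star (h i) * h j).re ≤ N i j * (‖h i‖ * ‖h j‖) :=
          mul_le_mul_of_nonneg_left h2 (hoff i j hij)
      _ = _ := by ring

/-- The entries of `Q` of unknown sign multiply squares of coordinates of `u`, which do not change.
-/
theorem dotProduct_mulVec_sumElim_mono
    (hQ : ∀ i j, (¬ ∃ k : Fin m, i = Sum.inr k ∧ j = Sum.inr k) → 0 ≤ Q i j)
    {x x' : Fin n → ℝ} {u : Fin m → ℝ} (hx : ∀ i, 0 ≤ x i) (hu : ∀ k, 0 ≤ u k)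
    (hxx : ∀ i, x i ≤ x' i) :
    Sum.elim x u ⬝ᵥ (Q *ᵥ Sum.elim x u) ≤ Sum.elim x' u ⬝ᵥ (Q *ᵥ Sum.elim x' u) := by
  simp only [dotProduct_mulVec_eq_sum_sum]
  refine Finset.sum_le_sum fun i _ => Finset.sum_le_sum fun j _ => ?_
  have h0 : ∀ i, 0 ≤ (Sum.elim x u : Fin n ⊕ Fin m → ℝ) i := by
    rintro (i | i)
    exacts [hx i, hu i]
  have h1 : ∀ i, (Sum.elim x u : Fin n ⊕ Fin m → ℝ) i ≤ Sum.elim x' u i := by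
    rintro (i | i)
    exacts [hxx i, le_rfl]
  by_cases h : ∃ k : Fin m, i = Sum.inr k ∧ j = Sum.inr k
  · obtain ⟨k, rfl, rfl⟩ := h
    exact le_rfl
  · have hq := hQ i j h
    exact mul_le_mul (mul_le_mul_of_nonneg_right (h1 i) hq) (h1 j) (h0 j)
      (mul_nonneg ((h0 i).trans (h1 i)) hq)

theorem re_freqMatrix_le (hA : ∀ i j, 0 ≤ A i j) (hA_schur : IsSchur A) (hB : ∀ i j, 0 ≤ B i j)
    (hQ : ∀ i j, (¬ ∃ k : Fin m, i = Sum.inr k ∧ j = Sum.inr k) → 0 ≤ Q i j)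
    (ω : ℝ) (w : Fin m → ℂ) :
    (star w ⬝ᵥ (freqMatrix A B Q ω *ᵥ w)).re ≤
      (fun k => ‖w k‖) ⬝ᵥ (staticMatrix A B Q *ᵥ fun k => ‖w k‖) := by
  set s := Complex.exp (Complex.I * (ω : ℂ)) with hs
  have hs1 : ‖s‖ = 1 := by rw [hs, mul_comm, Complex.norm_exp_ofReal_mul_I]
  have hdet := isUnit_smul_one_sub_of_notMem_spectrum (A := A.map ((↑) : ℝ → ℂ)) (z := s)
    fun h => (hA_schur s h).ne hs1
  set z := ((s • (1 : Matrix (Fin n) (Fin n) ℂ) - A.map ((↑) : ℝ → ℂ))⁻¹ *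
    B.map ((↑) : ℝ → ℂ)) *ᵥ w with hz
  have hquad : star w ⬝ᵥ (freqMatrix A B Q ω *ᵥ w) =
      star (Sum.elim z w) ⬝ᵥ (Q.map ((↑) : ℝ → ℂ) *ᵥ Sum.elim z w) := by
    simp only [freqMatrix, ← mulVec_mulVec]
    rw [dotProduct_mulVec, ← star_mulVec, fromRows_mulVec, one_mulVec, ← mulVec_mulVec, ← hs]
    simp only [hz, mulVec_mulVec]
  have hzeq : s • z = A.map ((↑) : ℝ → ℂ) *ᵥ z + B.map ((↑) : ℝ → ℂ) *ᵥ w := by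
    have h1 : (s • (1 : Matrix (Fin n) (Fin n) ℂ) - A.map ((↑) : ℝ → ℂ)) *ᵥ z =
        B.map ((↑) : ℝ → ℂ) *ᵥ w := by
      rw [hz, mulVec_mulVec, mul_nonsing_inv_cancel_left _ _ hdet]
    rw [← h1, sub_mulVec, smul_mulVec, one_mulVec]
    abel
  have hnorm : ∀ {κ : Type} [Fintype κ] (C : Matrix (Fin n) κ ℝ) (v : κ → ℂ) (i : Fin n),
      (∀ i j, 0 ≤ C i j) → ‖(C.map ((↑) : ℝ → ℂ) *ᵥ v) i‖ ≤ (C *ᵥ fun j => ‖v j‖) i := by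
    intro κ _ C v i hC
    refine (norm_sum_le _ _).trans_eq (Finset.sum_congr rfl fun j _ => ?_)
    simp [abs_of_nonneg (hC i j)]
  -- As `|e^{iω}| = 1`, taking moduli gives `(I - A) |z| ≤ B |w|`; then apply `(I - A)⁻¹ ≥ 0`.
  have hzle : ∀ i, ‖z i‖ ≤ (((1 - A)⁻¹ * B) *ᵥ fun k => ‖w k‖) i := by
    intro i
    have h2 : (fun i => ‖z i‖) = (1 - A)⁻¹ *ᵥ ((1 - A) *ᵥ fun i => ‖z i‖) := by
      rw [mulVec_mulVec, nonsing_inv_mul _ hA_schur.isUnit_det, one_mulVec]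
    refine (congrFun h2 i).trans_le ?_
    rw [← mulVec_mulVec]
    refine mulVec_mono_of_nonneg (hA_schur.inv_nonneg hA) (fun l => ?_) i
    have h3 : ‖z l‖ = ‖(A.map ((↑) : ℝ → ℂ) *ᵥ z) l + (B.map ((↑) : ℝ → ℂ) *ᵥ w) l‖ := by
      rw [← Pi.add_apply, ← hzeq, Pi.smul_apply, norm_smul, hs1, one_mul]
    have h4 := norm_add_le ((A.map ((↑) : ℝ → ℂ) *ᵥ z) l) ((B.map ((↑) : ℝ → ℂ) *ᵥ w) l)
    have h5 := hnorm A z l hA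
    have h6 := hnorm B w l hB
    rw [sub_mulVec, one_mulVec, Pi.sub_apply]
    linarith
  rw [hquad, dotProduct_staticMatrix_mulVec]
  have hoff : ∀ i j, i ≠ j → 0 ≤ Q i j := fun i j hij =>
    hQ i j (by rintro ⟨k, rfl, rfl⟩; exact hij rfl)
  refine (re_dotProduct_mulVec_le_of_metzler hoff _).trans ?_
  have h7 : (fun i => ‖(Sum.elim z w : Fin n ⊕ Fin m → ℂ) i‖) =
      Sum.elim (fun i => ‖z i‖) fun k => ‖w k‖ := by
    ext (i | i) <;> rfl
  rw [h7]
  exact dotProduct_mulVec_sumElim_mono hQ (fun i => norm_nonneg _) (fun k => norm_nonneg _) hzle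

theorem freqMatrix_zero (hA_schur : IsSchur A) :
    freqMatrix A B Q 0 = (staticMatrix A B Q).map ((↑) : ℝ → ℂ) := by
  have h1 : (1 - A.map ((↑) : ℝ → ℂ))⁻¹ = ((1 - A)⁻¹).map ((↑) : ℝ → ℂ) := by
    apply inv_eq_left_inv
    rw [← map_ofReal_one_sub]
    have h2 := map_mul (Complex.ofRealHom.mapMatrix (m := Fin n)) (1 - A)⁻¹ (1 - A)
    rw [nonsing_inv_mul _ hA_schur.isUnit_det, map_one] at h2
    exact h2.symm
  have hmul : ∀ {κ μ ν : Type} [Fintype μ] (C : Matrix κ μ ℝ) (D : Matrix μ ν ℝ),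
      (C * D).map ((↑) : ℝ → ℂ) = C.map ((↑) : ℝ → ℂ) * D.map ((↑) : ℝ → ℂ) := by
    intro κ μ ν _ C D
    exact Matrix.map_mul (f := Complex.ofRealHom)
  have hH : (fromRows ((1 - A)⁻¹ * B) (1 : Matrix (Fin m) (Fin m) ℝ)).map ((↑) : ℝ → ℂ) =
      fromRows ((1 - A.map ((↑) : ℝ → ℂ))⁻¹ * B.map ((↑) : ℝ → ℂ)) 1 := by
    rw [h1, ← hmul]
    ext (i | i) j
    · rfl
    · simp [one_apply, apply_ite]
  have hHt : ((fromRows ((1 - A)⁻¹ * B) (1 : Matrix (Fin m) (Fin m) ℝ))ᵀ).map ((↑) : ℝ → ℂ) =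
      (fromRows ((1 - A.map ((↑) : ℝ → ℂ))⁻¹ * B.map ((↑) : ℝ → ℂ)) 1)ᴴ := by
    rw [← hH]
    ext i j
    simp
  simp only [freqMatrix, staticMatrix]
  rw [hmul, hmul, hH, hHt]
  simp

theorem ofReal_dotProduct_mulVec {ι : Type*} [Fintype ι] (N : Matrix ι ι ℝ) (u : ι → ℝ) :
    star (fun k => (u k : ℂ)) ⬝ᵥ (N.map ((↑) : ℝ → ℂ) *ᵥ fun k => (u k : ℂ)) =
      ((u ⬝ᵥ (N *ᵥ u) : ℝ) : ℂ) := by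
  simp [dotProduct, mulVec]

theorem re_neg_quadratic {ι : Type*} [Fintype ι] {F : Matrix ι ι ℂ} (hF : F.IsHermitian)
    (w : ι → ℂ) :
    star w ⬝ᵥ (-F *ᵥ w) = ((-(star w ⬝ᵥ (F *ᵥ w)).re : ℝ) : ℂ) := by
  have h := hF.im_star_dotProduct_mulVec_self w
  rw [neg_mulVec, dotProduct_neg]
  apply Complex.ext
  · simp
  · simpa using h

theorem freqMatrix_posSemidef_iff (hA : ∀ i j, 0 ≤ A i j) (hA_schur : IsSchur A)
    (hB : ∀ i j, 0 ≤ B i j) (hQs : Q.IsSymm)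
    (hQ : ∀ i j, (¬ ∃ k : Fin m, i = Sum.inr k ∧ j = Sum.inr k) → 0 ≤ Q i j) :
    (∀ ω : ℝ, 0 ≤ ω → (-freqMatrix A B Q ω).PosSemidef) ↔ (-staticMatrix A B Q).PosSemidef := by
  rw [(staticMatrix_isSymm hQs).posSemidef_neg_iff]
  constructor
  · intro h u
    have h1 := (h 0 le_rfl).dotProduct_mulVec_nonneg fun k => (u k : ℂ)
    rw [freqMatrix_zero hA_schur, neg_mulVec, dotProduct_neg, ofReal_dotProduct_mulVec,
      ← Complex.ofReal_neg, Complex.zero_le_real] at h1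
    linarith
  · intro h ω _
    refine .of_dotProduct_mulVec_nonneg (freqMatrix_isHermitian hQs ω).neg fun w => ?_
    rw [re_neg_quadratic (freqMatrix_isHermitian hQs ω), Complex.zero_le_real]
    have h1 := re_freqMatrix_le hA hA_schur hB hQ ω w
    have h2 := h fun k => ‖w k‖
    linarith

theorem freqMatrix_posDef_iff (hA : ∀ i j, 0 ≤ A i j) (hA_schur : IsSchur A)
    (hB : ∀ i j, 0 ≤ B i j) (hQs : Q.IsSymm)
    (hQ : ∀ i j, (¬ ∃ k : Fin m, i = Sum.inr k ∧ j = Sum.inr k) → 0 ≤ Q i j) :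
    (∀ ω : ℝ, 0 ≤ ω → (-freqMatrix A B Q ω).PosDef) ↔ (-staticMatrix A B Q).PosDef := by
  rw [(staticMatrix_isSymm hQs).posDef_neg_iff]
  constructor
  · intro h u hu
    have hu' : (fun k => (u k : ℂ)) ≠ 0 := fun h0 => hu (funext fun k => by
      have := congrFun h0 k
      simpa using this)
    have h1 := (h 0 le_rfl).dotProduct_mulVec_pos hu'
    rw [freqMatrix_zero hA_schur, neg_mulVec, dotProduct_neg, ofReal_dotProduct_mulVec,
      ← Complex.ofReal_neg, Complex.zero_lt_real] at h1
    linarith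
  · intro h ω _
    refine .of_dotProduct_mulVec_pos (freqMatrix_isHermitian hQs ω).neg fun w hw => ?_
    rw [re_neg_quadratic (freqMatrix_isHermitian hQs ω), Complex.zero_lt_real]
    have h1 := re_freqMatrix_le hA hA_schur hB hQ ω w
    have hw' : (fun k => ‖w k‖) ≠ 0 := fun h0 => hw (funext fun k => by
      have := congrFun h0 k
      simpa using this)
    have h2 := h _ hw'
    linarith

end Frequency

/-! ### Uniform bounds on `P` and the nonstrict matrix inequality. -/

section AntiStabilizable

variable {n m : ℕ} {A : Matrix (Fin n) (Fin n) ℝ} {B : Matrix (Fin n) (Fin m) ℝ}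
  {Q : Matrix (Fin n ⊕ Fin m) (Fin n ⊕ Fin m) ℝ}

/-- A matrix with all eigenvalues outside the closed unit disc has a Schur inverse. -/
theorem exists_isSchur_inverse {F : Matrix (Fin n) (Fin n) ℝ}
    (hF : ∀ z ∈ spectrum ℂ (F.map ((↑) : ℝ → ℂ)), 1 < ‖z‖) :
    ∃ E : Matrix (Fin n) (Fin n) ℝ, IsSchur E ∧ F * E = 1 := by
  have h0 : (0 : ℂ) ∉ spectrum ℂ (F.map ((↑) : ℝ → ℂ)) := fun h => by
    have := hF 0 h
    rw [norm_zero] at this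
    linarith
  have hdetC : IsUnit (F.map ((↑) : ℝ → ℂ)).det := by
    have h1 := spectrum.zero_notMem_iff ℂ |>.1 h0
    exact (isUnit_iff_isUnit_det _).1 h1
  have hdet := isUnit_det_of_map_ofReal hdetC
  refine ⟨F⁻¹, fun z hz => ?_, mul_nonsing_inv _ hdet⟩
  have hmul : ∀ C D : Matrix (Fin n) (Fin n) ℝ, C * D = 1 →
      C.map ((↑) : ℝ → ℂ) * D.map ((↑) : ℝ → ℂ) = 1 := by
    intro C D h
    have h2 := map_mul (Complex.ofRealHom.mapMatrix (m := Fin n)) C D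
    rw [h, map_one] at h2
    exact h2.symm
  let U : (Matrix (Fin n) (Fin n) ℂ)ˣ :=
    ⟨F.map ((↑) : ℝ → ℂ), F⁻¹.map ((↑) : ℝ → ℂ), hmul _ _ (mul_nonsing_inv _ hdet),
      hmul _ _ (nonsing_inv_mul _ hdet)⟩
  have hz0 : z ≠ 0 := by
    rintro rfl
    exact (spectrum.zero_notMem_iff ℂ).2 (U⁻¹).isUnit hz
  have h3 : (((Units.mk0 z hz0)⁻¹ : ℂˣ) : ℂ) ∈ spectrum ℂ (U : Matrix (Fin n) (Fin n) ℂ) := by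
    have := (spectrum.inv_mem_iff (R := ℂ) (r := Units.mk0 z hz0) (a := U⁻¹)).1 hz
    rwa [inv_inv] at this
  have h4 := hF _ h3
  rw [Units.val_inv_eq_inv_val, Units.val_mk0, norm_inv] at h4
  exact (one_lt_inv₀ (norm_pos_iff.2 hz0)).1 h4

theorem exists_sum_sq_pow_le {E : Matrix (Fin n) (Fin n) ℝ} (hE : IsSchur E) :
    ∃ k : ℕ, ∑ i, ∑ j, (E ^ k) j i ^ 2 ≤ 1 / 2 := by
  have h : Tendsto (fun k : ℕ => ∑ i, ∑ j, (E ^ k) j i ^ 2) atTop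
      (𝓝 (∑ _i : Fin n, ∑ _j : Fin n, (0 : ℝ) ^ 2)) :=
    tendsto_finsetSum _ fun i _ => tendsto_finsetSum _ fun j _ => (hE.tendsto_pow j i).pow 2
  have h' := h.eventually_le_const (u := 1 / 2) (by norm_num)
  exact h'.exists

/-- Diagonal solutions of a Stein-type inequality with Schur `E` are bounded uniformly. -/
theorem exists_bound_of_stein {E : Matrix (Fin n) (Fin n) ℝ} (hE : IsSchur E)
    (r : (Fin n → ℝ) → ℝ) :
    ∃ C : ℝ, ∀ d : Fin n → ℝ, (∀ i, 0 ≤ d i) →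
      (∀ z, z ⬝ᵥ (diagonal d *ᵥ z) ≤ (E *ᵥ z) ⬝ᵥ (diagonal d *ᵥ (E *ᵥ z)) + r z) →
      ∀ i, d i ≤ C := by
  obtain ⟨k, hk⟩ := exists_sum_sq_pow_le hE
  -- After `k` iterations, summing over basis vectors gives `τ ≤ τ / 2 + S` for the trace `τ`, where
  -- `S` is the accumulated `r` terms; hence `τ ≤ 2 S`.
  refine ⟨2 * ∑ i, ∑ l ∈ Finset.range k, r ((E ^ l) *ᵥ Pi.single i 1), fun d hd h i => ?_⟩
  set τ := ∑ j, d j with hτ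
  have hdτ : ∀ j, d j ≤ τ := fun j =>
    Finset.single_le_sum (fun l _ => hd l) (Finset.mem_univ j)
  have hiter : ∀ (l : ℕ) (z : Fin n → ℝ), z ⬝ᵥ (diagonal d *ᵥ z) ≤
      ((E ^ l) *ᵥ z) ⬝ᵥ (diagonal d *ᵥ ((E ^ l) *ᵥ z)) +
        ∑ q ∈ Finset.range l, r ((E ^ q) *ᵥ z) := by
    intro l z
    induction l with
    | zero => simp
    | succ l ih =>
      have h1 := h ((E ^ l) *ᵥ z)
      rw [mulVec_mulVec z E, ← pow_succ'] at h1
      rw [Finset.sum_range_succ]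
      linarith
  have hquad : ∀ z : Fin n → ℝ, z ⬝ᵥ (diagonal d *ᵥ z) = ∑ j, d j * z j ^ 2 := fun z => by
    simp only [dotProduct, mulVec_diagonal]
    exact Finset.sum_congr rfl fun j _ => by ring
  have hdi : ∀ i, d i ≤ τ * ∑ j, (E ^ k) j i ^ 2 +
      ∑ q ∈ Finset.range k, r ((E ^ q) *ᵥ Pi.single i 1) := by
    intro i
    have h1 := hiter k (Pi.single i 1)
    rw [hquad, hquad] at h1
    have h2 : ∑ j, d j * (Pi.single i 1 : Fin n → ℝ) j ^ 2 = d i := by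
      simp [Pi.single_apply]
    have h3 : ∑ j, d j * ((E ^ k) *ᵥ Pi.single i 1) j ^ 2 ≤ τ * ∑ j, (E ^ k) j i ^ 2 := by
      rw [Finset.mul_sum]
      refine Finset.sum_le_sum fun j _ => ?_
      rw [mulVec_single_one, col_apply]
      exact mul_le_mul_of_nonneg_right (hdτ j) (sq_nonneg _)
    linarith
  have hsum : τ ≤ τ * ∑ i, ∑ j, (E ^ k) j i ^ 2 +
      ∑ i, ∑ q ∈ Finset.range k, r ((E ^ q) *ᵥ Pi.single i 1) := by
    rw [Finset.mul_sum, ← Finset.sum_add_distrib]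
    exact Finset.sum_le_sum fun i _ => hdi i
  have hτ0 : 0 ≤ τ := Finset.sum_nonneg fun j _ => hd j
  have := mul_le_mul_of_nonneg_left hk hτ0
  have := hdτ i
  linarith

theorem sub_diagonal_isSymm (hQs : Q.IsSymm) (ε : ℝ) :
    (Q - fromBlocks 0 0 0 (ε • 1)).IsSymm := by
  refine hQs.sub (IsSymm.fromBlocks ?_ ?_ ?_) <;> simp [IsSymm]

theorem sub_diagonal_nonneg
    (hQ : ∀ i j, (¬ ∃ k : Fin m, i = Sum.inr k ∧ j = Sum.inr k) → 0 ≤ Q i j) (ε : ℝ) :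
    ∀ i j, (¬ ∃ k : Fin m, i = Sum.inr k ∧ j = Sum.inr k) →
      0 ≤ (Q - fromBlocks 0 0 0 (ε • 1) : Matrix (Fin n ⊕ Fin m) (Fin n ⊕ Fin m) ℝ) i j := by
  intro i j hij
  have h := hQ i j hij
  rw [Matrix.sub_apply]
  rcases i with i | i <;> rcases j with j | j
  · simpa using h
  · simpa using h
  · simpa using h
  · have hne : i ≠ j := fun h => hij ⟨i, rfl, by rw [h]⟩
    simpa [one_apply, hne] using h

theorem dotProduct_sub_diagonal_mulVec (ε : ℝ) (x : Fin n → ℝ) (u : Fin m → ℝ) :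
    Sum.elim x u ⬝ᵥ ((Q - fromBlocks 0 0 0 (ε • 1)) *ᵥ Sum.elim x u) =
      Sum.elim x u ⬝ᵥ (Q *ᵥ Sum.elim x u) - ε * (u ⬝ᵥ u) := by
  rw [sub_mulVec, dotProduct_sub, fromBlocks_mulVec, sumElim_dotProduct_sumElim]
  simp [smul_mulVec]

/-- The perturbation lowers the static form by `ε |u|²`. It touches only the last `m` diagonal
entries of `Q`, so the sign pattern is kept. -/
theorem staticMatrix_sub_diagonal_posDef (hQs : Q.IsSymm) (h : (-staticMatrix A B Q).PosSemidef)
    {ε : ℝ} (hε : 0 < ε) : (-staticMatrix A B (Q - fromBlocks 0 0 0 (ε • 1))).PosDef := by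
  rw [(staticMatrix_isSymm (sub_diagonal_isSymm hQs ε)).posDef_neg_iff]
  intro u hu
  rw [dotProduct_staticMatrix_mulVec, dotProduct_sub_diagonal_mulVec,
    ← dotProduct_staticMatrix_mulVec]
  have h1 := (staticMatrix_isSymm hQs).posSemidef_neg_iff.1 h u
  have h2 : 0 < u ⬝ᵥ u := by
    have := dotProduct_star_self_pos_iff.2 hu
    simpa using this
  have := mul_pos hε h2
  linarith

/-- The nonstrict linear matrix inequality, by a compactness argument. -/
theorem exists_lmi_of_staticMatrix_posSemidef (hA : ∀ i j, 0 ≤ A i j) (hA_schur : IsSchur A)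
    (hB : ∀ i j, 0 ≤ B i j) (hQs : Q.IsSymm)
    (hQ : ∀ i j, (¬ ∃ k : Fin m, i = Sum.inr k ∧ j = Sum.inr k) → 0 ≤ Q i j)
    (hAB : IsAntiStabilizable A B) (h : (-staticMatrix A B Q).PosSemidef) :
    ∃ d : Fin n → ℝ, (∀ i, 0 ≤ d i) ∧ (-lmiMatrix A B Q (diagonal d)).PosSemidef := by
  have hlmi : ∀ k : ℕ, ∃ d : Fin n → ℝ, (∀ i, 0 ≤ d i) ∧ ∀ x u,
      Sum.elim x u ⬝ᵥ (Q *ᵥ Sum.elim x u) - 1 / ((k : ℝ) + 1) * (u ⬝ᵥ u) +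
      (A *ᵥ x + B *ᵥ u) ⬝ᵥ (diagonal d *ᵥ (A *ᵥ x + B *ᵥ u)) - x ⬝ᵥ (diagonal d *ᵥ x) ≤ 0 := by
    intro k
    have hε : (0 : ℝ) < 1 / ((k : ℝ) + 1) := by positivity
    have hs := sub_diagonal_isSymm hQs (1 / ((k : ℝ) + 1))
    have hn := sub_diagonal_nonneg hQ (1 / ((k : ℝ) + 1))
    obtain ⟨x, p, u, hx, hp, hu, hAx, hlp⟩ := exists_lp_of_staticMatrix_posDef hA hA_schur hB hs hn
      (staticMatrix_sub_diagonal_posDef hQs h hε)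
    obtain ⟨d, hd, hL⟩ := exists_lmi_of_lp hA hB hs hn hx hp hu (fun i => (hAx i).le) hlp
    refine ⟨d, fun i => (hd i).le, fun x u => ?_⟩
    have h1 := (lmiMatrix_isSymm hs d).posSemidef_neg_iff.1 hL.posSemidef (Sum.elim x u)
    rwa [dotProduct_lmiMatrix_mulVec, dotProduct_sub_diagonal_mulVec] at h1
  choose d hd0 hd using hlmi
  obtain ⟨K, hK⟩ := hAB
  obtain ⟨E, hE, hFE⟩ := exists_isSchur_inverse hK
  -- Substituting `x = E z`, `u = K E z`, where `E = (A + B K)⁻¹`, gives `A x + B u = z` and turns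
  -- the LMI into a Stein inequality. Bounding `1 / (k + 1)` by 1 makes the remainder independent of
  -- `k`.
  obtain ⟨C, hC⟩ := exists_bound_of_stein hE fun z =>
    (K *ᵥ (E *ᵥ z)) ⬝ᵥ (K *ᵥ (E *ᵥ z)) -
      Sum.elim (E *ᵥ z) (K *ᵥ (E *ᵥ z)) ⬝ᵥ (Q *ᵥ Sum.elim (E *ᵥ z) (K *ᵥ (E *ᵥ z)))
  have hdC : ∀ k i, d k i ≤ C := by
    intro k
    refine hC (d k) (hd0 k) fun z => ?_
    have h1 := hd k (E *ᵥ z) (K *ᵥ (E *ᵥ z))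
    have h2 : A *ᵥ (E *ᵥ z) + B *ᵥ (K *ᵥ (E *ᵥ z)) = z := by
      rw [mulVec_mulVec _ B K, ← add_mulVec, mulVec_mulVec, hFE, one_mulVec]
    rw [h2] at h1
    have h3 : (0 : ℝ) ≤ (K *ᵥ (E *ᵥ z)) ⬝ᵥ (K *ᵥ (E *ᵥ z)) :=
      Finset.sum_nonneg fun i _ => mul_self_nonneg _
    have h4 : 1 / ((k : ℝ) + 1) ≤ 1 := by
      rw [div_le_one (by positivity)]
      linarith [(Nat.cast_nonneg k : (0 : ℝ) ≤ k)]
    have := mul_le_mul_of_nonneg_right h4 h3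
    linarith
  obtain ⟨d', hd', φ, hφ, hlim⟩ := (isCompact_Icc (a := (0 : Fin n → ℝ)) (b := fun _ => C)
    ).tendsto_subseq fun k => ⟨hd0 k, hdC k⟩
  refine ⟨d', hd'.1, ?_⟩
  rw [(lmiMatrix_isSymm hQs d').posSemidef_neg_iff]
  intro y
  rw [← Sum.elim_comp_inl_inr y, dotProduct_lmiMatrix_mulVec]
  generalize y ∘ Sum.inl = x
  generalize y ∘ Sum.inr = u
  have hquad : ∀ v : Fin n → ℝ, Tendsto (fun k => v ⬝ᵥ (diagonal (d (φ k)) *ᵥ v)) atTop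
      (𝓝 (v ⬝ᵥ (diagonal d' *ᵥ v))) := fun v => by
    have hcont : Continuous fun e : Fin n → ℝ => v ⬝ᵥ (diagonal e *ᵥ v) := by
      simp only [dotProduct, mulVec_diagonal]
      fun_prop
    exact (hcont.tendsto d').comp hlim
  have hε : Tendsto (fun k => 1 / ((φ k : ℝ) + 1)) atTop (𝓝 0) :=
    tendsto_one_div_add_atTop_nhds_zero_nat.comp hφ.tendsto_atTop
  have hall := ((tendsto_const_nhds (x := Sum.elim x u ⬝ᵥ (Q *ᵥ Sum.elim x u))).sub
    (hε.mul_const (u ⬝ᵥ u))).add (hquad (A *ᵥ x + B *ᵥ u)) |>.sub (hquad x)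
  have := le_of_tendsto' hall fun k => hd (φ k) x u
  simpa using this

end AntiStabilizable

/-! ### Assembly of the equivalences. -/

theorem mainTheorem2 {n m : ℕ} (A : Matrix (Fin n) (Fin n) ℝ) (B : Matrix (Fin n) (Fin m) ℝ)
    (Q : Matrix (Fin n ⊕ Fin m) (Fin n ⊕ Fin m) ℝ)
    (hA : ∀ i j, 0 ≤ A i j) (hA_schur : IsSchur A) (hB : ∀ i j, 0 ≤ B i j)
    (hQ_symm : Q.IsSymm)
    (hQ : ∀ i j, (¬ ∃ k : Fin m, i = Sum.inr k ∧ j = Sum.inr k) → 0 ≤ Q i j) :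
    -- non-strict inequalities, under anti-stabilizability
    (IsAntiStabilizable A B →
      List.TFAE [
        ∀ ω : ℝ, 0 ≤ ω → (-freqMatrix A B Q ω).PosSemidef,
        (-staticMatrix A B Q).PosSemidef,
        ∃ P : Matrix (Fin n) (Fin n) ℝ, P.IsDiag ∧ P.PosSemidef ∧ (-lmiMatrix A B Q P).PosSemidef,
        ∃ (x p : Fin n → ℝ) (u : Fin m → ℝ),
          (∀ i, 0 ≤ x i) ∧ (∀ i, 0 ≤ p i) ∧ (∀ k, 0 < u k) ∧
          (∀ i, (A *ᵥ x + B *ᵥ u) i ≤ x i) ∧ (∀ j, lpVector A B Q x p u j ≤ 0)]) ∧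
    -- strict inequalities, without anti-stabilizability; for the sign constraints on `P`, `x`,
    -- `p`, `u` themselves both the strict and the non-strict reading are covered
    List.TFAE [
      ∀ ω : ℝ, 0 ≤ ω → (-freqMatrix A B Q ω).PosDef,
      (-staticMatrix A B Q).PosDef,
      ∃ P : Matrix (Fin n) (Fin n) ℝ, P.IsDiag ∧ P.PosDef ∧ (-lmiMatrix A B Q P).PosDef,
      ∃ P : Matrix (Fin n) (Fin n) ℝ, P.IsDiag ∧ P.PosSemidef ∧ (-lmiMatrix A B Q P).PosDef,
      ∃ (x p : Fin n → ℝ) (u : Fin m → ℝ),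
        (∀ i, 0 < x i) ∧ (∀ i, 0 < p i) ∧ (∀ k, 0 < u k) ∧
        (∀ i, (A *ᵥ x + B *ᵥ u) i < x i) ∧ (∀ j, lpVector A B Q x p u j < 0),
      ∃ (x p : Fin n → ℝ) (u : Fin m → ℝ),
        (∀ i, 0 ≤ x i) ∧ (∀ i, 0 ≤ p i) ∧ (∀ k, 0 ≤ u k) ∧
        (∀ i, (A *ᵥ x + B *ᵥ u) i < x i) ∧ (∀ j, lpVector A B Q x p u j < 0)] := by
  refine ⟨fun hAB => ?_, ?_⟩
  · tfae_have 1 ↔ 2 := freqMatrix_posSemidef_iff hA hA_schur hB hQ_symm hQ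
    -- Among the nonstrict implications, only this one needs anti-stabilizability.
    tfae_have 2 → 3 := fun h => by
      obtain ⟨d, hd, hL⟩ :=
        exists_lmi_of_staticMatrix_posSemidef hA hA_schur hB hQ_symm hQ hAB h
      exact ⟨diagonal d, isDiag_diagonal d, posSemidef_diagonal_iff.2 hd, hL⟩
    tfae_have 3 → 2 := fun ⟨_, _, _, hL⟩ => staticMatrix_posSemidef_of_lmi hA_schur hQ_symm hL
    tfae_have 2 → 4 := exists_lp_of_staticMatrix_posSemidef hA hA_schur hB hQ_symm hQ
    tfae_have 4 → 2 := fun ⟨_, _, _, _, _, hu, hAx, hlp⟩ =>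
      staticMatrix_posSemidef_of_lp hA hA_schur hB hQ_symm hQ hu hAx hlp
    tfae_finish
  · tfae_have 1 ↔ 2 := freqMatrix_posDef_iff hA hA_schur hB hQ_symm hQ
    tfae_have 2 → 5 := exists_lp_of_staticMatrix_posDef hA hA_schur hB hQ_symm hQ
    tfae_have 5 → 3 := fun ⟨_, _, _, hx, hp, hu, hAx, hlp⟩ => by
      obtain ⟨d, hd, hL⟩ :=
        exists_lmi_of_lp hA hB hQ_symm hQ hx hp hu (fun i => (hAx i).le) hlp
      exact ⟨diagonal d, isDiag_diagonal d, posDef_diagonal_iff.2 hd, hL⟩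
    tfae_have 3 → 4 := fun ⟨P, hd, hP, hL⟩ => ⟨P, hd, hP.posSemidef, hL⟩
    tfae_have 4 → 2 := fun ⟨_, _, _, hL⟩ => staticMatrix_posDef_of_lmi hA_schur hQ_symm hL
    tfae_have 5 → 6 := fun ⟨x, p, u, hx, hp, hu, hAx, hlp⟩ =>
      ⟨x, p, u, fun i => (hx i).le, fun i => (hp i).le, fun k => (hu k).le, hAx, hlp⟩
    -- Here `u ≥ 0` is enough: `M u < 0` with `M` Metzler forces `u > 0`.
    tfae_have 6 → 2 := fun ⟨_, _, _, _, _, hu, hAx, hlp⟩ =>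
      staticMatrix_posDef_of_lp hA hA_schur hB hQ_symm hQ hu (fun i => (hAx i).le) hlp
    tfae_finish
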